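/- Let $n,m\ge 0$ be integers. Consider the problem $\min\{f(y) : y\in\mathbb R^n,\ h(y)=0\}$ with $f:\mathbb R^n\to\mathbb R$ and $h:\mathbb R^n\to\mathbb R^m$ twice continuously differentiable. All norms are Euclidean (spectral for matrices). Let $L(y,\lambda)=f(y)+\lambda\cdot h(y)$, and for $\beta>0$ put $\mathfrak M_\beta=\{y\in\mathbb R^n : \|h(y)\|\le\beta\}$. A pair $(y,\lambda)\in\mathbb R^n\times\mathbb R^m$ is called $((\varepsilon_0,\varepsilon_1,\varepsilon_2),\gamma)$-AFAC (approximately feasible, approximately 2-critical) if $$\|h(y)\|\le\varepsilon_0,\qquad \|\nabla_y L(y,\lambda)\|\le\varepsilon_1,\qquad u^T\nabla^2_{yy}L(y,\lambda)\,u\ge-\varepsilon_2\ \text{ for every unit vector } u \text{ with } \|\nabla h(y)u\|\le\gamma .$$ For $\varrho>0$, $\varrho$-LICQ holds at $y$ if the smallest of the $m$ singular values of the $m\times n$ Jacobian $\nabla h(y)$ is at least $\varrho$; in particular $\nabla h(y)$ then has full row rank $m$. An algorithm here is a deterministic procedure that receives an initial point and tolerances and has access to $f,h$ only through evaluations: at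 each step it chooses, from its input and the answers so far, either a point $y$ at which it obtains $f,\nabla f,\nabla^2f,h,\nabla h$ and $\nabla^2h_i$ $(i\in[m])$, or it stops with an output. Its cost is the number of evaluations. **Theorem.** For all $n,m$ there is an algorithm with the following property. For all $\beta,\varrho>0$ and $M\ge0$ there is a constant $C$, depending only on $n,m,\beta,\varrho,M$, such that the following holds for all $f,h$ as above and all $y_0\in\mathbb R^n$ satisfying: * $y_0\in\mathfrak M_\beta$; * $f,\nabla f,\nabla^2f$ and $\nabla h_i,\nabla^2h_i$ for $i\in[m]$ are bounded by $M$ and Lipschitz continuous with constant $M$ on $\mathfrak M_\beta$; * $\varrho$-LICQ holds at every $y\in\mathfrak M_\beta$. Let $L_f=\sup_{y\in\mathfrak M_\beta}\|\nabla f(y)\|$ and $R_\lambda=2+2\varrho^{-1}L_f$. Let $\varepsilon_0,\varepsilon_1,\varepsilon_2>0$ and $\gamma\ge0$ be such that $$\varepsilon_0\le\beta,\qquad \varepsilon_1\le1,\qquad \varepsilon_1^2\le\tfrac1{16}R_\lambda^{-1}\varepsilon_0\varepsilon_2,\qquad \gamma^2\le\tfrac1{16}R_\lambda^{-3}\varepsilon_0\varepsilon_2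 .$$ Then the algorithm, initialized at $y_0$ with tolerances $\varepsilon_0,\varepsilon_1,\varepsilon_2,\gamma$, stops after at most $$C\,\max\{\varepsilon_0^{-2}\varepsilon_1^{-2},\ \varepsilon_0^{-3}\varepsilon_2^{-3}\}$$ evaluations and outputs an $((\varepsilon_0,\varepsilon_1,\varepsilon_2),\gamma)$-AFAC pair $(y,\lambda)$ with $\|\lambda\|\le R_\lambda$. -/

import Mathlib

open scoped NNReal

noncomputable section

/-- `ℝⁿ` with the Euclidean norm. -/
abbrev EucSp (n : ℕ) : Type := EuclideanSpace ℝ (Fin n)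

/-- The Hessian `∇²f(y)`, as a linear operator (so its norm is the spectral norm). -/
def hessianOp {n : ℕ} (f : EucSp n → ℝ) (y : EucSp n) : EucSp n →L[ℝ] EucSp n :=
  fderiv ℝ (gradient f) y

/-- The Lagrangian `L(y, lam) = f(y) + lam · h(y)`. -/
def lagrangian {n m : ℕ} (f : EucSp n → ℝ) (h : EucSp n → EucSp m) (lam : EucSp m)
    (y : EucSp n) : ℝ :=
  f y + inner ℝ lam (h y)

/-- `(y, lam)` is an `((ε₀, ε₁, ε₂), γ)`-approximately feasible approximately 2-critical (AFAC)
pair of `min f(y)` subject to `h(y) = 0`. The Jacobian `∇h(y)` is `fderiv ℝ h y`. -/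
structure IsAFACPair {n m : ℕ} (f : EucSp n → ℝ) (h : EucSp n → EucSp m)
    (ε₀ ε₁ ε₂ γ : ℝ) (y : EucSp n) (lam : EucSp m) : Prop where
  feasible : ‖h y‖ ≤ ε₀
  first_order : ‖gradient (lagrangian f h lam) y‖ ≤ ε₁
  second_order : ∀ u : EucSp n, ‖u‖ = 1 → ‖fderiv ℝ h y u‖ ≤ γ →
    -ε₂ ≤ inner ℝ u (hessianOp (lagrangian f h lam) y u)

/-- The set `{y : ‖h(y)‖ ≤ β}`. -/
def nearFeasibleSet {n m : ℕ} (h : EucSp n → EucSp m) (β : ℝ) : Set (EucSp n) :=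
  {y | ‖h y‖ ≤ β}

/-- `ϱ`-LICQ at `y`: the smallest of the `m` singular values of the `m × n` matrix `∇h(y)` is at
least `ϱ`. Mathlib lists the singular values from index `0` in decreasing order and continues the
list by zeros, so that the condition (for `ϱ > 0`) forces `∇h(y)` to have full row rank `m`. -/
def SatisfiesLICQ {n m : ℕ} (h : EucSp n → EucSp m) (ϱ : ℝ) (y : EucSp n) : Prop :=
  ∀ i < m, ϱ ≤ (fderiv ℝ h y).toLinearMap.singularValues i

/-- On `S` the map `g` is bounded by `M` and Lipschitz continuous with constant `M`. -/
def BddLipschitzOn {X Y : Type} [PseudoEMetricSpace X] [SeminormedAddCommGroup Y]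
    (M : ℝ≥0) (g : X → Y) (S : Set X) : Prop :=
  (∀ y ∈ S, ‖g y‖ ≤ M) ∧ LipschitzOnWith M g S

/-- `f, ∇f, ∇²f` and `∇hᵢ, ∇²hᵢ` are bounded and Lipschitz continuous on `S`, with bounds and
Lipschitz constants at most `M`. -/
structure HasBddLipschitzData {n m : ℕ} (f : EucSp n → ℝ) (h : EucSp n → EucSp m)
    (M : ℝ≥0) (S : Set (EucSp n)) : Prop where
  objective : BddLipschitzOn M f S
  objective_grad : BddLipschitzOn M (gradient f) S
  objective_hess : BddLipschitzOn M (hessianOp f) S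
  constraint_grad : ∀ i : Fin m, BddLipschitzOn M (gradient (fun y => h y i)) S
  constraint_hess : ∀ i : Fin m, BddLipschitzOn M (hessianOp (fun y => h y i)) S

/-- `L_f`: the supremum of `‖∇f(y)‖` over `y ∈ S`. -/
def gradSup {n : ℕ} (f : EucSp n → ℝ) (S : Set (EucSp n)) : ℝ :=
  ⨆ y : S, ‖gradient f (y : EucSp n)‖

/-- The bound `R_λ = 2 + 2 ϱ⁻¹ L_f` on the multipliers. -/
def multiplierBound (ϱ Lf : ℝ) : ℝ := 2 + 2 * ϱ⁻¹ * Lf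

/-- What an evaluation at a point `y` returns: `f(y), ∇f(y), ∇²f(y), h(y), ∇h(y)` and the
`∇²hᵢ(y)`. -/
structure EvalData (n m : ℕ) : Type where
  fVal : ℝ
  fGrad : EucSp n
  fHess : EucSp n →L[ℝ] EucSp n
  hVal : EucSp m
  hJac : EucSp n →L[ℝ] EucSp m
  hHess : Fin m → (EucSp n →L[ℝ] EucSp n)

/-- The evaluation of `f`, `h` and their derivatives at `y`. -/
def evalAt {n m : ℕ} (f : EucSp n → ℝ) (h : EucSp n → EucSp m) (y : EucSp n) :
    EvalData n m where
  fVal := f y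
  fGrad := gradient f y
  fHess := hessianOp f y
  hVal := h y
  hJac := fderiv ℝ h y
  hHess := fun i => hessianOp (fun z => h z i) y

/-- The tolerances `(ε₀, ε₁, ε₂)` and `γ`. -/
structure Tolerances : Type where
  ε₀ : ℝ
  ε₁ : ℝ
  ε₂ : ℝ
  γ : ℝ

/-- A deterministic algorithm for problems with `n` variables and `m` constraints that has access
to `f` and `h` only by evaluating them and their derivatives. It is started with an initial point
and tolerances. In each state it either asks for the evaluation at a point, and then moves to a new
state that depends on the current state and on the answer, or stops with an output `(y, lam)`.
The cost is the number of evaluations. -/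
structure EvalAlgorithm (n m : ℕ) : Type 1 where
  State : Type
  init : EucSp n → Tolerances → State
  act : State → EucSp n ⊕ (EucSp n × EucSp m)
  next : State → EvalData n m → State

/-- `A.RunsTo f h s N out`: started in state `s` and applied to `(f, h)`, the algorithm `A` makes
exactly `N` evaluations and then stops with output `out`. -/
inductive EvalAlgorithm.RunsTo {n m : ℕ} (A : EvalAlgorithm n m)
    (f : EucSp n → ℝ) (h : EucSp n → EucSp m) :
    A.State → ℕ → EucSp n × EucSp m → Prop
  | halt {s : A.State} {out : EucSp n × EucSp m} (hs : A.act s = Sum.inr out) :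
      RunsTo A f h s 0 out
  | query {s : A.State} {y : EucSp n} {N : ℕ} {out : EucSp n × EucSp m}
      (hs : A.act s = Sum.inl y) (hr : RunsTo A f h (A.next s (evalAt f h y)) N out) :
      RunsTo A f h s (N + 1) out

end

/-! The method is descent on the quadratic penalty `P = f + (c/2)‖h‖²` with `c = p/ε₀`. With `λ = c
h(y)` one has `∇P = ∇_y L`, and the Hessian of `P` is that of `L` plus `c ∇hᵀ∇h`. Where `‖∇P‖ ≤ ε₁/κ
≤ ϱ`, LICQ gives `‖λ‖ ≤ R/2`, hence `‖h‖ ≤ ε₀/4` if `p ≥ 2R`; and `c‖∇h u‖² ≤ ε₂/2` for `‖∇h u‖ ≤ γ`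
if `p ≤ 8R³`. So at such a point either `(y, λ)` is acceptable or `P` has curvature at most `-ε₂/2`
in some direction (`exists_neg_curvature_of_not_isAccepted`).

On `𝔐_β` the Hessian of `P` and its Lipschitz constant are `O(c)`, so a gradient step lowers `P` by
order `ε₁²/c` and a curvature step by order `ε₂³/c²` (`penalty_gradient_step`,
`penalty_curvature_step`). Steps stay in `𝔐_β`: away from its boundary they are too short to leave,
and near it LICQ lets `c ∇hᵀh` dominate `∇f`, so that `‖h‖` decreases. As `P` varies by `O(c)` on
`𝔐_β`, the number of steps is of order `max (c²/ε₁²) (c³/ε₂³)`, which is the stated rate.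

The algorithm knows neither `R` nor a suitable `κ`. It tries all pairs `(p, κ)` of natural numbers
in turn, each with a finite budget. Acceptance is tested on the evaluation alone, so unsuitable runs
do no harm, and a suitable pair has an index bounded in terms of `m, β, ϱ, M`
(`exists_isAccepted_penaltyIterate`, `exists_runsTo_of_isAccepted`). -/

noncomputable section

open Set Filter Topology

/-! ### Linear algebra: LICQ as a lower bound for the adjoint Jacobian. -/

/-- If all the `m` singular values of `T : E → F` with `dim F = m` are at least `ϱ`, then the
adjoint of `T` expands norms by the factor `ϱ`. -/
theorem LinearMap.mul_norm_le_norm_adjoint_of_le_singularValues {n m : ℕ}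
    (T : EucSp n →ₗ[ℝ] EucSp m) {ϱ : ℝ} (hϱ : 0 < ϱ)
    (hT : ∀ i < m, ϱ ≤ T.singularValues i) (v : EucSp m) :
    ϱ * ‖v‖ ≤ ‖LinearMap.adjoint T v‖ := by
  have hrank : m ≤ Module.finrank ℝ (LinearMap.range T) := by
    rcases m with _ | k
    · simp
    · exact T.singularValues_pos_iff_lt_finrank_range.1 (hϱ.trans_le (hT k (Nat.lt_succ_self k)))
  have hm : Module.finrank ℝ (EucSp m) = m := by simp
  have hn : Module.finrank ℝ (EucSp n) = n := by simp
  have hle : Module.finrank ℝ (LinearMap.range T) ≤ m :=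
    (Submodule.finrank_le _).trans_eq hm
  have hsurj : LinearMap.range T = ⊤ := by
    apply Submodule.eq_top_of_finrank_eq
    omega
  -- With `v = T x`, both squared norms are diagonal in an eigenbasis of `T*T`, namely `∑ σᵢ² xᵢ²`
  -- and `∑ σᵢ⁴ xᵢ²`, and the inequality holds term by term.
  obtain ⟨x, rfl⟩ := LinearMap.range_eq_top.1 hsurj v
  set hS := T.isSymmetric_adjoint_comp_self
  set b := hS.eigenvectorBasis hn
  have h1 : ‖T x‖ ^ 2 = ∑ i, hS.eigenvalues hn i * (b.repr x i) ^ 2 := by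
    rw [← real_inner_self_eq_norm_sq, ← LinearMap.adjoint_inner_left, ← b.repr.inner_map_map,
      PiLp.inner_apply]
    refine Finset.sum_congr rfl fun i _ => ?_
    have := hS.eigenvectorBasis_apply_self_apply hn x i
    simp only [LinearMap.comp_apply] at this
    rw [this]
    simp [b]
    ring
  have h2 : ‖LinearMap.adjoint T (T x)‖ ^ 2 = ∑ i, (hS.eigenvalues hn i * b.repr x i) ^ 2 := by
    rw [← b.repr.norm_map, EuclideanSpace.norm_sq_eq]
    refine Finset.sum_congr rfl fun i _ => ?_
    have := hS.eigenvectorBasis_apply_self_apply hn x i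
    simp only [LinearMap.comp_apply] at this
    rw [this]
    simp [b, mul_pow]
  have h3 : (ϱ * ‖T x‖) ^ 2 ≤ ‖LinearMap.adjoint T (T x)‖ ^ 2 := by
    rw [mul_pow, h1, h2, Finset.mul_sum]
    refine Finset.sum_le_sum fun i _ => ?_
    have hs := T.sq_singularValues_fin hn i
    change T.singularValues i ^ 2 = hS.eigenvalues hn i at hs
    rw [← hs]
    by_cases hi : (i : ℕ) < m
    · have hq : ϱ ^ 2 ≤ T.singularValues i ^ 2 := pow_le_pow_left₀ hϱ.le (hT i hi) 2
      have := mul_le_mul_of_nonneg_right hq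
        (mul_nonneg (sq_nonneg (T.singularValues i)) (sq_nonneg (b.repr x i)))
      nlinarith [this]
    · rw [T.singularValues_eq_zero_iff_le_finrank_range.2 (by omega)]
      simp
  exact le_of_sq_le_sq h3 (norm_nonneg _)

theorem SatisfiesLICQ.mul_norm_le {n m : ℕ} {h : EucSp n → EucSp m} {ϱ : ℝ} {y : EucSp n}
    (hL : SatisfiesLICQ h ϱ y) (hϱ : 0 < ϱ) (v : EucSp m) :
    ϱ * ‖v‖ ≤ ‖ContinuousLinearMap.adjoint (fderiv ℝ h y) v‖ :=
  (fderiv ℝ h y).toLinearMap.mul_norm_le_norm_adjoint_of_le_singularValues hϱ hL v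

/-! ### One-variable calculus: continuous induction and Taylor bounds. -/

/-- A differentiable function on `[0, t]` that starts below the level `b`, and that at each point
up to which it has stayed below `b` is either strictly below `b` or has negative derivative,
stays below `b`. -/
theorem le_of_lt_or_deriv_neg {ψ ψ' : ℝ → ℝ} {b t : ℝ} (hψ : ∀ s, HasDerivAt ψ (ψ' s) s)
    (h0 : ψ 0 ≤ b)
    (hstep : ∀ x ∈ Ico 0 t, (∀ s ∈ Icc 0 x, ψ s ≤ b) → ψ x < b ∨ ψ' x < 0) :
    ∀ s ∈ Icc 0 t, ψ s ≤ b := by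
  have hc : Continuous ψ := continuous_iff_continuousAt.2 fun s => (hψ s).continuousAt
  have hcl : IsClosed ({s | ψ s ≤ b} ∩ Icc 0 t) :=
    (isClosed_le hc continuous_const).inter isClosed_Icc
  refine hcl.Icc_subset_of_forall_mem_nhdsGT_of_Icc_subset h0 fun x hx hxs => ?_
  have hxb : ψ x ≤ b := hxs ⟨hx.1, le_rfl⟩
  rcases hstep x hx fun s hs => hxs hs with hlt | hneg
  · exact mem_nhdsWithin_of_mem_nhds
      ((hc.continuousAt.eventually (gt_mem_nhds hlt)).mono fun _ hz => le_of_lt hz)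
  · have hslope := (hasDerivAt_iff_tendsto_slope.1 (hψ x)).eventually (gt_mem_nhds hneg)
    have : ∀ᶠ z in 𝓝[>] x, slope ψ x z < 0 :=
      hslope.filter_mono (nhdsWithin_mono _ fun z hz => ne_of_gt hz)
    filter_upwards [this, self_mem_nhdsWithin] with z hz hxz
    rw [slope_def_field, div_neg_iff] at hz
    have hxz' : x < z := hxz
    rcases hz with ⟨_, h⟩ | ⟨h, _⟩
    · linarith
    · exact le_trans (by linarith) hxb

/-- Comparison of functions by their derivatives on `[0, t]`. -/
theorem le_of_deriv_le_on {φ φ' B B' : ℝ → ℝ} {t : ℝ} (ht : 0 ≤ t)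
    (hφ : ∀ s, HasDerivAt φ (φ' s) s) (hB : ∀ s, HasDerivAt B (B' s) s) (h0 : φ 0 ≤ B 0)
    (hle : ∀ s ∈ Icc 0 t, φ' s ≤ B' s) : φ t ≤ B t :=
  image_le_of_deriv_right_le_deriv_boundary
    (fun s _ => (hφ s).continuousAt.continuousWithinAt) (fun s _ => (hφ s).hasDerivWithinAt) h0
    (fun s _ => (hB s).continuousAt.continuousWithinAt) (fun s _ => (hB s).hasDerivWithinAt)
    (fun s hs => hle s ⟨hs.1, hs.2.le⟩) ⟨ht, le_rfl⟩

/-- The derivative of a cubic polynomial. -/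
theorem hasDerivAt_cubic (a b c e s : ℝ) :
    HasDerivAt (fun s => a + b * s + c * s ^ 2 + e * s ^ 3) (b + 2 * c * s + 3 * e * s ^ 2) s := by
  have h1 := (hasDerivAt_id' s).const_mul b
  have h2 := (hasDerivAt_pow 2 s).const_mul c
  have h3 := (hasDerivAt_pow 3 s).const_mul e
  refine (((h1.const_add a).fun_add h2).fun_add h3).congr_deriv ?_
  norm_num
  ring

/-- Second order Taylor bound. -/
theorem le_taylor_two {φ φ' φ'' : ℝ → ℝ} {t L : ℝ} (ht : 0 ≤ t)
    (hφ : ∀ s, HasDerivAt φ (φ' s) s) (hφ' : ∀ s, HasDerivAt φ' (φ'' s) s)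
    (hle : ∀ s ∈ Icc 0 t, φ'' s ≤ L) : φ t ≤ φ 0 + φ' 0 * t + L / 2 * t ^ 2 := by
  have h1 : ∀ s ∈ Icc 0 t, φ' s ≤ φ' 0 + L * s := fun s hs =>
    le_of_deriv_le_on (B := fun s => φ' 0 + L * s) (B' := fun _ => L) hs.1 hφ'
      (fun s => by simpa using ((hasDerivAt_id s).const_mul L).const_add (φ' 0)) (by simp)
      fun r hr => hle r ⟨hr.1, hr.2.trans hs.2⟩
  refine le_of_deriv_le_on (B := fun s => φ 0 + φ' 0 * s + L / 2 * s ^ 2)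
    (B' := fun s => φ' 0 + L * s) ht hφ (fun s => ?_) (by simp) h1
  simpa [mul_div_cancel₀] using hasDerivAt_cubic (φ 0) (φ' 0) (L / 2) 0 s

/-- Third order Taylor bound. -/
theorem le_taylor_three {φ φ' φ'' : ℝ → ℝ} {t L : ℝ} (ht : 0 ≤ t)
    (hφ : ∀ s, HasDerivAt φ (φ' s) s) (hφ' : ∀ s, HasDerivAt φ' (φ'' s) s)
    (hle : ∀ s ∈ Icc 0 t, φ'' s ≤ φ'' 0 + L * s) :
    φ t ≤ φ 0 + φ' 0 * t + φ'' 0 / 2 * t ^ 2 + L / 6 * t ^ 3 := by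
  have h1 : ∀ s ∈ Icc 0 t, φ' s ≤ φ' 0 + φ'' 0 * s + L / 2 * s ^ 2 := fun s hs => by
    refine le_of_deriv_le_on (B := fun s => φ' 0 + φ'' 0 * s + L / 2 * s ^ 2)
      (B' := fun s => φ'' 0 + L * s) hs.1 hφ' (fun s => ?_) (by simp)
      fun r hr => hle r ⟨hr.1, hr.2.trans hs.2⟩
    simpa [mul_div_cancel₀] using hasDerivAt_cubic (φ' 0) (φ'' 0) (L / 2) 0 s
  refine le_of_deriv_le_on (B := fun s => φ 0 + φ' 0 * s + φ'' 0 / 2 * s ^ 2 + L / 6 * s ^ 3)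
    (B' := fun s => φ' 0 + φ'' 0 * s + L / 2 * s ^ 2) ht hφ (fun s => ?_) (by simp) h1
  refine (hasDerivAt_cubic (φ 0) (φ' 0) (φ'' 0 / 2) (L / 6) s).congr_deriv ?_
  ring

/-! ### Derivatives along lines and of the Lagrangian. -/

section Calculus

variable {n m : ℕ} {f : EucSp n → ℝ} {h : EucSp n → EucSp m}

theorem ContDiff.gradient_one (hf : ContDiff ℝ 2 f) : ContDiff ℝ 1 (gradient f) :=
  (InnerProductSpace.toDual ℝ (EucSp n)).symm.contDiff.comp
    (hf.fderiv_right (m := 1) (by norm_num))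

theorem hasDerivAt_line (y d : EucSp n) (s : ℝ) : HasDerivAt (fun s : ℝ => y + s • d) d s := by
  simpa using ((hasDerivAt_id s).smul_const d).const_add y

theorem hasDerivAt_comp_line (hf : ContDiff ℝ 2 f) (y d : EucSp n) (s : ℝ) :
    HasDerivAt (fun s : ℝ => f (y + s • d)) (inner ℝ (gradient f (y + s • d)) d) s := by
  have hd : DifferentiableAt ℝ f (y + s • d) := (hf.differentiable (by norm_num)) _
  rw [inner_gradient_left]
  exact hd.hasFDerivAt.comp_hasDerivAt s (hasDerivAt_line y d s)

theorem hasDerivAt_inner_gradient_line (hf : ContDiff ℝ 2 f) (y d : EucSp n) (s : ℝ) :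
    HasDerivAt (fun s : ℝ => inner ℝ (gradient f (y + s • d)) d)
      (inner ℝ d (hessianOp f (y + s • d) d)) s := by
  have hd : DifferentiableAt ℝ (gradient f) (y + s • d) :=
    (hf.gradient_one.differentiable (by norm_num)) _
  have hd' : HasFDerivAt (gradient f) (hessianOp f (y + s • d)) (y + s • d) := hd.hasFDerivAt
  have h1 := hd'.comp_hasDerivAt s (hasDerivAt_line y d s)
  simpa [real_inner_comm] using h1.inner ℝ (hasDerivAt_const s d)

theorem ContDiff.coord (hh : ContDiff ℝ 2 h) (i : Fin m) : ContDiff ℝ 2 (fun y => h y i) :=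
  contDiff_euclidean.1 hh i

theorem fderiv_coord (hh : ContDiff ℝ 2 h) (y u : EucSp n) (i : Fin m) :
    fderiv ℝ h y u i = inner ℝ (gradient (fun z => h z i) y) u := by
  have hd : DifferentiableAt ℝ h y := (hh.differentiable (by norm_num)) _
  rw [inner_gradient_left]
  exact (DFunLike.congr_fun (((EuclideanSpace.proj (𝕜 := ℝ) i).hasFDerivAt.comp y
    hd.hasFDerivAt).fderiv) u).symm

theorem adjoint_fderiv (hh : ContDiff ℝ 2 h) (y : EucSp n) (v : EucSp m) :
    ContinuousLinearMap.adjoint (fderiv ℝ h y) v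
      = ∑ i, v i • gradient (fun z => h z i) y := by
  refine ext_inner_right ℝ fun u => ?_
  rw [ContinuousLinearMap.adjoint_inner_left, sum_inner, PiLp.inner_apply]
  refine Finset.sum_congr rfl fun i _ => ?_
  rw [fderiv_coord hh, inner_smul_left]
  simp [mul_comm]

theorem gradient_lagrangian (hf : ContDiff ℝ 2 f) (hh : ContDiff ℝ 2 h) (lam : EucSp m)
    (y : EucSp n) :
    gradient (lagrangian f h lam) y
      = gradient f y + ContinuousLinearMap.adjoint (fderiv ℝ h y) lam := by
  have hdf : DifferentiableAt ℝ f y := (hf.differentiable (by norm_num)) _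
  have hdh : DifferentiableAt ℝ h y := (hh.differentiable (by norm_num)) _
  refine ext_inner_right ℝ fun u => ?_
  rw [inner_gradient_left, inner_add_left, inner_gradient_left,
    ContinuousLinearMap.adjoint_inner_left]
  have h1 : HasFDerivAt (lagrangian f h lam)
      (fderiv ℝ f y + (innerSL ℝ lam).comp (fderiv ℝ h y)) y :=
    hdf.hasFDerivAt.add ((innerSL ℝ lam).hasFDerivAt.comp y hdh.hasFDerivAt)
  rw [h1.fderiv]
  simp

theorem hessianOp_lagrangian (hf : ContDiff ℝ 2 f) (hh : ContDiff ℝ 2 h) (lam : EucSp m)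
    (y : EucSp n) :
    hessianOp (lagrangian f h lam) y
      = hessianOp f y + ∑ i, lam i • hessianOp (fun z => h z i) y := by
  have h1 : gradient (lagrangian f h lam)
      = fun z => gradient f z + ∑ i, lam i • gradient (fun z => h z i) z := by
    funext z
    rw [gradient_lagrangian hf hh, adjoint_fderiv hh]
  have hdf : DifferentiableAt ℝ (gradient f) y := (hf.gradient_one.differentiable (by norm_num)) _
  have hdh : ∀ i, DifferentiableAt ℝ (gradient (fun z => h z i)) y := fun i =>
    ((hh.coord i).gradient_one.differentiable (by norm_num)) _
  unfold hessianOp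
  rw [h1]
  exact (hdf.hasFDerivAt.add (HasFDerivAt.fun_sum fun i _ =>
    (hdh i).hasFDerivAt.const_smul (lam i))).fderiv

end Calculus

/-! ### The penalty function and its derivatives. -/

/-- The quadratic penalty function `f + (c / 2) ‖h‖²`. -/
def penalty {n m : ℕ} (c : ℝ) (f : EucSp n → ℝ) (h : EucSp n → EucSp m) (y : EucSp n) : ℝ :=
  f y + c / 2 * ‖h y‖ ^ 2

/-- The gradient of the quadratic penalty function, computed from an evaluation. -/
def EvalData.penaltyGrad {n m : ℕ} (D : EvalData n m) (c : ℝ) : EucSp n :=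
  D.fGrad + c • ContinuousLinearMap.adjoint D.hJac D.hVal

/-- The quadratic form of the Hessian of the quadratic penalty function, computed from an
evaluation. -/
def EvalData.penaltyCurv {n m : ℕ} (D : EvalData n m) (c : ℝ) (d : EucSp n) : ℝ :=
  inner ℝ d (D.fHess d) + c * (‖D.hJac d‖ ^ 2 + ∑ i, D.hVal i * inner ℝ d (D.hHess i d))

section Calculus

variable {n m : ℕ} {f : EucSp n → ℝ} {h : EucSp n → EucSp m}

theorem penaltyCurv_evalAt (hh : ContDiff ℝ 2 h) (c : ℝ) (y d : EucSp n) :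
    (evalAt f h y).penaltyCurv c d = inner ℝ d (hessianOp f y d) +
      c * ∑ i, ((inner ℝ (gradient (fun z => h z i) y) d) ^ 2 +
        h y i * inner ℝ d (hessianOp (fun z => h z i) y d)) := by
  simp only [EvalData.penaltyCurv, evalAt, EuclideanSpace.real_norm_sq_eq, fderiv_coord hh,
    Finset.sum_add_distrib]

theorem hasDerivAt_penalty_line (hf : ContDiff ℝ 2 f) (hh : ContDiff ℝ 2 h) (c : ℝ)
    (y d : EucSp n) (s : ℝ) :
    HasDerivAt (fun s : ℝ => penalty c f h (y + s • d))
      (inner ℝ ((evalAt f h (y + s • d)).penaltyGrad c) d) s := by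
  simp only [penalty, EvalData.penaltyGrad, evalAt, EuclideanSpace.real_norm_sq_eq,
    adjoint_fderiv hh]
  have h1 := HasDerivAt.fun_sum (u := Finset.univ) fun (i : Fin m) _ =>
    (hasDerivAt_comp_line (hh.coord i) y d s).fun_pow 2
  refine ((hasDerivAt_comp_line hf y d s).fun_add (h1.const_mul (c / 2))).congr_deriv ?_
  rw [inner_add_left, inner_smul_left, sum_inner, Finset.mul_sum, Finset.mul_sum]
  congr 1
  refine Finset.sum_congr rfl fun i _ => ?_
  rw [inner_smul_left]
  simp
  ring

theorem hasDerivAt_penaltyGrad_line (hf : ContDiff ℝ 2 f) (hh : ContDiff ℝ 2 h) (c : ℝ)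
    (y d : EucSp n) (s : ℝ) :
    HasDerivAt (fun s : ℝ => inner ℝ ((evalAt f h (y + s • d)).penaltyGrad c) d)
      ((evalAt f h (y + s • d)).penaltyCurv c d) s := by
  rw [penaltyCurv_evalAt hh]
  simp only [EvalData.penaltyGrad, evalAt, adjoint_fderiv hh, inner_add_left, inner_smul_left,
    sum_inner]
  have h1 := HasDerivAt.fun_sum (u := Finset.univ) fun (i : Fin m) _ =>
    (hasDerivAt_comp_line (hh.coord i) y d s).fun_mul
      (hasDerivAt_inner_gradient_line (hh.coord i) y d s)
  refine ((hasDerivAt_inner_gradient_line hf y d s).fun_add (h1.const_mul c)).congr_deriv ?_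
  simp only [sq]

end Calculus

/-! ### Bounds on `{‖h‖ ≤ β}` and segments inside it. -/

section Bounds

variable {n m : ℕ} {f : EucSp n → ℝ} {h : EucSp n → EucSp m} {β c : ℝ} {M : ℝ≥0}

theorem abs_coord_le {y : EucSp n} (hy : y ∈ nearFeasibleSet h β) (i : Fin m) : |h y i| ≤ β :=
  (PiLp.norm_apply_le (h y) i).trans hy

theorem norm_le_sum_abs (v : EucSp m) : ‖v‖ ≤ ∑ i, |v i| := by
  have hv : v = ∑ i, v i • EuclideanSpace.single i (1 : ℝ) := by
    simpa using ((EuclideanSpace.basisFun (Fin m) ℝ).sum_repr v).symm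
  conv_lhs => rw [hv]
  refine (norm_sum_le _ _).trans_eq (Finset.sum_congr rfl fun i _ => ?_)
  simp [norm_smul]

theorem norm_adjoint_fderiv_le (hh : ContDiff ℝ 2 h)
    (hB : HasBddLipschitzData f h M (nearFeasibleSet h β)) {y : EucSp n}
    (hy : y ∈ nearFeasibleSet h β) :
    ‖ContinuousLinearMap.adjoint (fderiv ℝ h y) (h y)‖ ≤ m * (β * M) := by
  rw [adjoint_fderiv hh]
  refine (norm_sum_le _ _).trans ?_
  calc ∑ i, ‖h y i • gradient (fun z => h z i) y‖ ≤ ∑ _i : Fin m, β * M := by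
        refine Finset.sum_le_sum fun i _ => ?_
        rw [norm_smul]
        exact mul_le_mul (abs_coord_le hy i) ((hB.constraint_grad i).1 y hy) (norm_nonneg _)
          ((abs_nonneg _).trans (abs_coord_le hy i))
    _ = _ := by simp

theorem norm_penaltyGrad_le (hh : ContDiff ℝ 2 h) (hc : 0 ≤ c)
    (hB : HasBddLipschitzData f h M (nearFeasibleSet h β)) {y : EucSp n}
    (hy : y ∈ nearFeasibleSet h β) :
    ‖(evalAt f h y).penaltyGrad c‖ ≤ M + c * (m * (β * M)) := by
  refine (norm_add_le _ _).trans (add_le_add (hB.objective_grad.1 y hy) ?_)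
  rw [norm_smul, Real.norm_of_nonneg hc]
  exact mul_le_mul_of_nonneg_left (norm_adjoint_fderiv_le hh hB hy) hc

theorem abs_inner_map_self_le {L : ℝ} (T : EucSp n →L[ℝ] EucSp n) (hT : ‖T‖ ≤ L) (d : EucSp n) :
    |inner ℝ d (T d)| ≤ L * ‖d‖ ^ 2 := by
  calc |inner ℝ d (T d)| ≤ ‖d‖ * ‖T d‖ := abs_real_inner_le_norm _ _
    _ ≤ ‖d‖ * (L * ‖d‖) := by gcongr; exact T.le_of_opNorm_le hT d
    _ = _ := by ring

theorem abs_penaltyCurv_le (hh : ContDiff ℝ 2 h) (hc : 0 ≤ c)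
    (hB : HasBddLipschitzData f h M (nearFeasibleSet h β)) {y : EucSp n}
    (hy : y ∈ nearFeasibleSet h β) (d : EucSp n) :
    |(evalAt f h y).penaltyCurv c d| ≤ (M + c * (m * (M ^ 2 + β * M))) * ‖d‖ ^ 2 := by
  have hβ : 0 ≤ β := (norm_nonneg _).trans hy
  rw [penaltyCurv_evalAt hh, add_mul]
  refine (abs_add_le _ _).trans
    (add_le_add (abs_inner_map_self_le _ (hB.objective_hess.1 y hy) d) ?_)
  rw [abs_mul, abs_of_nonneg hc, mul_assoc]
  refine mul_le_mul_of_nonneg_left ((Finset.abs_sum_le_sum_abs _ _).trans ?_) hc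
  calc _ ≤ ∑ _i : Fin m, ((M ^ 2 + β * M) * ‖d‖ ^ 2 : ℝ) := by
        refine Finset.sum_le_sum fun i _ => (abs_add_le _ _).trans ?_
        rw [add_mul]
        refine add_le_add ?_ ?_
        · rw [abs_pow, ← mul_pow]
          refine pow_le_pow_left₀ (abs_nonneg _) ((abs_real_inner_le_norm _ _).trans ?_) 2
          gcongr
          exact (hB.constraint_grad i).1 y hy
        · rw [abs_mul, mul_assoc]
          exact mul_le_mul (abs_coord_le hy i)
            (abs_inner_map_self_le _ ((hB.constraint_hess i).1 y hy) d) (abs_nonneg _) hβ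
    _ = _ := by simp; ring

/-- Differences of products are telescoped: `(a - b)(a + b)` contributes `2M²`, `(h z i - h y i) p`
contributes `M²`, and `h y i (p - q)` contributes `βM`. The Lipschitz bound for `h` is a hypothesis
because it is derived only along segments inside the set, which need not be convex. -/
theorem penaltyCurv_le_add (hh : ContDiff ℝ 2 h) (hc : 0 ≤ c)
    (hB : HasBddLipschitzData f h M (nearFeasibleSet h β)) {y z : EucSp n}
    (hy : y ∈ nearFeasibleSet h β) (hz : z ∈ nearFeasibleSet h β)
    (hyz : ∀ i, |h z i - h y i| ≤ M * ‖z - y‖) (d : EucSp n) :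
    (evalAt f h z).penaltyCurv c d ≤ (evalAt f h y).penaltyCurv c d +
      (M + c * (m * (3 * M ^ 2 + β * M))) * (‖z - y‖ * ‖d‖ ^ 2) := by
  have hβ : 0 ≤ β := (norm_nonneg _).trans hy
  have hop : ∀ {T : EucSp n → (EucSp n →L[ℝ] EucSp n)},
      LipschitzOnWith M T (nearFeasibleSet h β) →
      |inner ℝ d (T z d) - inner ℝ d (T y d)| ≤ M * (‖z - y‖ * ‖d‖ ^ 2) := by
    intro T hT
    rw [← inner_sub_right, ← sub_apply, ← mul_assoc]
    exact abs_inner_map_self_le _ (hT.norm_sub_le hz hy) d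
  have hi : ∀ i, ((inner ℝ (gradient (fun z => h z i) z) d) ^ 2 +
        h z i * inner ℝ d (hessianOp (fun z => h z i) z d)) -
      ((inner ℝ (gradient (fun z => h z i) y) d) ^ 2 +
        h y i * inner ℝ d (hessianOp (fun z => h z i) y d)) ≤
      (3 * M ^ 2 + β * M) * (‖z - y‖ * ‖d‖ ^ 2) := by
    intro i
    set a := inner ℝ (gradient (fun z => h z i) z) d
    set b := inner ℝ (gradient (fun z => h z i) y) d
    set p := inner ℝ d (hessianOp (fun z => h z i) z d) with hp
    set q := inner ℝ d (hessianOp (fun z => h z i) y d)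
    have h1 : |a - b| ≤ M * ‖z - y‖ * ‖d‖ := by
      rw [← inner_sub_left]
      refine (abs_real_inner_le_norm _ _).trans ?_
      gcongr
      exact (hB.constraint_grad i).2.norm_sub_le hz hy
    have h2 : |a + b| ≤ 2 * M * ‖d‖ := by
      rw [← inner_add_left]
      refine (abs_real_inner_le_norm _ _).trans ?_
      gcongr
      refine (norm_add_le _ _).trans ?_
      linarith [(hB.constraint_grad i).1 y hy, (hB.constraint_grad i).1 z hz]
    have h3 : |p - q| ≤ M * (‖z - y‖ * ‖d‖ ^ 2) := hop (hB.constraint_hess i).2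
    have h4 : |p| ≤ M * ‖d‖ ^ 2 := abs_inner_map_self_le _ ((hB.constraint_hess i).1 z hz) d
    have e1 : (a - b) * (a + b) ≤ (M * ‖z - y‖ * ‖d‖) * (2 * M * ‖d‖) :=
      (le_abs_self _).trans (by rw [abs_mul]; gcongr)
    have e2 : (h z i - h y i) * p ≤ (M * ‖z - y‖) * (M * ‖d‖ ^ 2) :=
      (le_abs_self _).trans (by rw [abs_mul]; gcongr; exact hyz i)
    have e3 : h y i * (p - q) ≤ β * (M * (‖z - y‖ * ‖d‖ ^ 2)) :=
      (le_abs_self _).trans (by rw [abs_mul]; gcongr; exact abs_coord_le hy i)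
    linarith
  have hsum := Finset.sum_le_sum fun i (_ : i ∈ Finset.univ) => hi i
  rw [Finset.sum_sub_distrib] at hsum
  have hsum' := mul_le_mul_of_nonneg_left hsum hc
  have hf' := (le_abs_self _).trans (hop hB.objective_hess.2)
  rw [penaltyCurv_evalAt hh, penaltyCurv_evalAt hh]
  simp only [Finset.sum_const, Finset.card_univ, Fintype.card_fin, nsmul_eq_mul] at hsum'
  linarith

theorem abs_coord_sub_le (hh : ContDiff ℝ 2 h)
    (hB : HasBddLipschitzData f h M (nearFeasibleSet h β)) {y d : EucSp n} {t : ℝ} (ht : 0 ≤ t)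
    (hseg : ∀ s ∈ Icc 0 t, y + s • d ∈ nearFeasibleSet h β) (i : Fin m) :
    |h (y + t • d) i - h y i| ≤ M * (t * ‖d‖) := by
  have hder := hasDerivAt_comp_line (hh.coord i) y d
  have hbd : ∀ s ∈ Icc 0 t,
      |inner ℝ (gradient (fun z => h z i) (y + s • d)) d| ≤ M * ‖d‖ := fun s hs =>
    (abs_real_inner_le_norm _ _).trans
      (by gcongr; exact (hB.constraint_grad i).1 _ (hseg s hs))
  have h1 := le_of_deriv_le_on (B := fun s => h y i + M * ‖d‖ * s) (B' := fun _ => M * ‖d‖) ht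
    hder (fun s => by simpa using hasDerivAt_cubic (h y i) (M * ‖d‖) 0 0 s) (by simp)
    fun s hs => (abs_le.1 (hbd s hs)).2
  have h2 := le_of_deriv_le_on (φ := fun s => h y i + -(M * ‖d‖) * s) (φ' := fun _ => -(M * ‖d‖))
    ht (fun s => by simpa using hasDerivAt_cubic (h y i) (-(M * ‖d‖)) 0 0 s) hder (by simp)
    fun s hs => (abs_le.1 (hbd s hs)).1
  rw [abs_le]
  constructor <;> linarith

theorem norm_constraint_le (hh : ContDiff ℝ 2 h)
    (hB : HasBddLipschitzData f h M (nearFeasibleSet h β)) {y d : EucSp n} {t : ℝ} (ht : 0 ≤ t)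
    (hseg : ∀ s ∈ Icc 0 t, y + s • d ∈ nearFeasibleSet h β) :
    ‖h (y + t • d)‖ ≤ ‖h y‖ + m * M * (t * ‖d‖) := by
  have h1 : ‖h (y + t • d) - h y‖ ≤ m * M * (t * ‖d‖) := by
    refine (norm_le_sum_abs _).trans ?_
    calc _ ≤ ∑ _i : Fin m, (M * (t * ‖d‖) : ℝ) :=
          Finset.sum_le_sum fun i _ => abs_coord_sub_le hh hB ht hseg i
      _ = _ := by simp; ring
  have h2 := norm_add_le (h y) (h (y + t • d) - h y)
  rw [add_sub_cancel] at h2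
  linarith

/-- The data with zero objective. -/
theorem HasBddLipschitzData.zero_objective {S : Set (EucSp n)} (hB : HasBddLipschitzData f h M S) :
    HasBddLipschitzData (fun _ => 0) h M S := by
  have hg : gradient (fun _ : EucSp n => (0 : ℝ)) = fun _ => 0 := by
    funext y
    exact gradient_fun_const y 0
  have hH : hessianOp (fun _ : EucSp n => (0 : ℝ)) = fun _ => 0 := by
    funext y
    simp [hessianOp, hg]
  refine ⟨⟨by simp, ?_⟩, ⟨by simp [hg], ?_⟩, ⟨by simp [hH], ?_⟩, hB.constraint_grad,
    hB.constraint_hess⟩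
  · exact LipschitzWith.const' _ |>.lipschitzOnWith
  · rw [hg]; exact LipschitzWith.const' _ |>.lipschitzOnWith
  · rw [hH]; exact LipschitzWith.const' _ |>.lipschitzOnWith

/-- A segment stays in `{‖h‖ ≤ β}` if at each of its points up to which it has stayed there either
`‖h‖ < β` or the derivative of `‖h‖² / 2` is negative. -/
theorem segment_mem_of_lt_or_inner_neg (hh : ContDiff ℝ 2 h) {y d : EucSp n} {t : ℝ}
    (hy : y ∈ nearFeasibleSet h β)
    (hstep : ∀ x ∈ Ico 0 t, (∀ s ∈ Icc 0 x, y + s • d ∈ nearFeasibleSet h β) →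
      ‖h (y + x • d)‖ < β ∨
      inner ℝ ((evalAt (fun _ => 0) h (y + x • d)).penaltyGrad 1) d < 0) :
    ∀ s ∈ Icc 0 t, y + s • d ∈ nearFeasibleSet h β := by
  have hβ : 0 ≤ β := (norm_nonneg _).trans hy
  -- With zero objective and `c = 1` the penalty is `‖h‖²/2`, so its derivative formulas serve for
  -- the constraint violation too.
  have hiff : ∀ z, penalty 1 (fun _ => 0) h z ≤ β ^ 2 / 2 ↔ z ∈ nearFeasibleSet h β := by
    intro z
    rw [nearFeasibleSet, mem_ofPred_eq, ← pow_le_pow_iff_left₀ (norm_nonneg _) hβ two_ne_zero,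
      penalty]
    constructor <;> intro <;> linarith
  have := le_of_lt_or_deriv_neg (b := β ^ 2 / 2) (t := t)
    (hasDerivAt_penalty_line (f := fun _ => 0) contDiff_const hh 1 y d)
    (by rw [hiff]; simpa using hy) fun x hx hxs => by
      refine (hstep x hx fun s hs => (hiff _).1 (hxs s hs)).imp_left fun hlt => ?_
      have := pow_lt_pow_left₀ hlt (norm_nonneg _) two_ne_zero
      simp only [penalty]
      linarith
  exact fun s hs => (hiff _).1 (this s hs)

/-- The growth bound for `‖h‖` presupposes that the segment stays in the set. Continuous induction
breaks the circle, since up to each point the bound yields `‖h‖ < β` strictly. -/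
theorem segment_mem_of_short (hh : ContDiff ℝ 2 h)
    (hB : HasBddLipschitzData f h M (nearFeasibleSet h β)) {y d : EucSp n} {t : ℝ}
    (hlt : ‖h y‖ + m * M * (t * ‖d‖) < β) (ht : 0 ≤ t) :
    ∀ s ∈ Icc 0 t, y + s • d ∈ nearFeasibleSet h β := by
  have h0 : 0 ≤ m * M * (t * ‖d‖) := by positivity
  refine segment_mem_of_lt_or_inner_neg hh (show ‖h y‖ ≤ β by linarith) fun x hx hxs => Or.inl ?_
  refine ((norm_constraint_le hh hB hx.1 hxs).trans ?_).trans_lt hlt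
  gcongr
  exact hx.2.le

end Bounds

/-! ### Descent steps for the penalty function. -/

section Steps

variable {n m : ℕ} {f : EucSp n → ℝ} {h : EucSp n → EucSp m} {β c ϱ κ : ℝ} {M : ℝ≥0}

/-- A step along the negative gradient of the penalty function from a point where `‖h‖` is not
small stays in `{‖h‖ ≤ β}`. -/
theorem segment_mem_of_neg_penaltyGrad (hh : ContDiff ℝ 2 h)
    (hB : HasBddLipschitzData f h M (nearFeasibleSet h β)) {y : EucSp n} {t : ℝ}
    (hy : y ∈ nearFeasibleSet h β) (hc : 0 < c)
    (hw : 0 < ‖ContinuousLinearMap.adjoint (fderiv ℝ h y) (h y)‖)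
    (hfw : 2 * ‖gradient f y‖ ≤ c * ‖ContinuousLinearMap.adjoint (fderiv ℝ h y) (h y)‖)
    (htc : 9 / 2 * (c * t * (M + m * (M ^ 2 + β * M))) < 1) :
    ∀ s ∈ Icc 0 t, y + s • (-(evalAt f h y).penaltyGrad c) ∈ nearFeasibleSet h β := by
  have hβ : 0 ≤ β := (norm_nonneg _).trans hy
  set g := (evalAt f h y).penaltyGrad c with hg
  set w := ContinuousLinearMap.adjoint (fderiv ℝ h y) (h y) with hwdef
  have hgw : g = gradient f y + c • w := rfl
  have hgn : ‖g‖ ≤ 3 / 2 * (c * ‖w‖) := by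
    rw [hgw]
    refine (norm_add_le _ _).trans ?_
    rw [norm_smul, Real.norm_of_nonneg hc.le]
    linarith
  have hip : 1 / 2 * (c * ‖w‖ ^ 2) ≤ inner ℝ w g := by
    rw [hgw, inner_add_right, inner_smul_right, real_inner_self_eq_norm_sq]
    have h1 := (abs_le.1 (abs_real_inner_le_norm w (gradient f y))).1
    nlinarith [mul_le_mul_of_nonneg_left hfw (norm_nonneg w)]
  have hcf : ContDiff ℝ 2 (fun _ : EucSp n => (0 : ℝ)) := contDiff_const
  refine segment_mem_of_lt_or_inner_neg hh hy fun x hx hxs => Or.inr ?_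
  have hder := hasDerivAt_penaltyGrad_line hcf hh 1 y (-g)
  have hA : 0 ≤ (M + m * (M ^ 2 + β * M) : ℝ) := by positivity
  set A : ℝ := M + m * (M ^ 2 + β * M) with hAdef
  have hcurv : ∀ s ∈ Icc 0 x,
      (evalAt (fun _ => 0) h (y + s • (-g))).penaltyCurv 1 (-g) ≤ A * ‖g‖ ^ 2 := fun s hs => by
    have := (le_abs_self _).trans
      (abs_penaltyCurv_le hh zero_le_one hB.zero_objective (hxs s hs) (-g))
    rwa [one_mul, norm_neg] at this
  have h1 := le_of_deriv_le_on
    (B := fun s => inner ℝ ((evalAt (fun _ => 0) h y).penaltyGrad 1) (-g) + A * ‖g‖ ^ 2 * s)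
    (B' := fun _ => A * ‖g‖ ^ 2) hx.1 hder
    (fun s => (((hasDerivAt_id' s).const_mul _).const_add _).congr_deriv (mul_one _)) (by simp) hcurv
  have h0 : inner ℝ ((evalAt (fun _ => 0) h y).penaltyGrad 1) (-g) = - inner ℝ w g := by
    simp only [EvalData.penaltyGrad, evalAt, gradient_fun_const]
    simp [hwdef]
  refine h1.trans_lt ?_
  simp only [h0]
  have hg2 : ‖g‖ ^ 2 ≤ 9 / 4 * (c * ‖w‖) ^ 2 := by
    have := pow_le_pow_left₀ (norm_nonneg g) hgn 2
    linarith
  have hxt : A * ‖g‖ ^ 2 * x ≤ A * (9 / 4 * (c * ‖w‖) ^ 2) * t := by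
    have := hx.1
    have := hx.2.le
    gcongr
  -- The derivative of `‖h‖²/2` along `-g` starts at most at `-c‖w‖²/2` and grows at rate at most
  -- `A‖g‖² ≤ (9/4) A c²‖w‖²`; the factor `9/2` in `htc` keeps it negative on `[0, t)`.
  have hfin : A * (9 / 4 * (c * ‖w‖) ^ 2) * t < 1 / 2 * (c * ‖w‖ ^ 2) := by
    have : 0 < 1 / 2 * (c * ‖w‖ ^ 2) := by positivity
    nlinarith [mul_lt_mul_of_pos_right htc this]
  linarith

/-- The constant in the bounds for the derivatives of the penalty function. -/
def penaltyConst (m : ℕ) (β M : ℝ) : ℝ := (1 + β) * M + m * (3 * M ^ 2 + β * M)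

/-- The step size parameter `κ` is sufficiently large. -/
structure IsLargeFactor (m : ℕ) (β ϱ M κ : ℝ) : Prop where
  one_le : 1 ≤ κ
  const_le : 5 * penaltyConst m β M ≤ κ
  displacement_lt : 4 * (m * M * penaltyConst m β M) < κ * β
  one_le_mul : 1 ≤ κ * ϱ
  gap_le : 2 * M * β + β ^ 2 / 2 ≤ κ

/-- The factor is a natural number so that the enumeration of runs reaches it, and it depends on `m,
β, ϱ, M` only. -/
theorem exists_isLargeFactor (m : ℕ) {β ϱ : ℝ} (hβ : 0 < β) (hϱ : 0 < ϱ) (M : ℝ≥0) :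
    ∃ k : ℕ, IsLargeFactor m β ϱ M k := by
  have hW : 0 ≤ penaltyConst m β M := by unfold penaltyConst; positivity
  set W := penaltyConst m β M
  obtain ⟨k, hk⟩ := exists_nat_ge
    (1 + 5 * W + 4 * (m * M * W) / β + ϱ⁻¹ + (2 * M * β + β ^ 2 / 2))
  have h1 : 0 ≤ 4 * (m * M * W) / β := by positivity
  have h2 : 0 < ϱ⁻¹ := by positivity
  have h3 : 0 ≤ 2 * M * β + β ^ 2 / 2 := by positivity
  refine ⟨k, ?_, ?_, ?_, ?_, ?_⟩
  · linarith
  · linarith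
  · rw [← div_lt_iff₀ hβ]; linarith
  · rw [← inv_le_iff_one_le_mul₀ hϱ]; linarith
  · linarith

/-- Since `c β ≥ 1`, the contribution `M` of the objective is at most `c β M`, so every bound
becomes linear in `c`. -/
theorem add_mul_le_mul_penaltyConst (hcβ : 1 ≤ c * β) (hc : 0 ≤ c) {B : ℝ}
    (hB : B ≤ m * (3 * M ^ 2 + β * M)) : M + c * B ≤ c * penaltyConst m β M := by
  have h1 : (M : ℝ) ≤ c * β * M := le_mul_of_one_le_left M.2 hcβ
  have h2 := mul_le_mul_of_nonneg_left hB hc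
  have h3 : 0 ≤ c * M := mul_nonneg hc M.2
  unfold penaltyConst
  linarith

theorem penalty_gradient_step (hf : ContDiff ℝ 2 f) (hh : ContDiff ℝ 2 h)
    (hB : HasBddLipschitzData f h M (nearFeasibleSet h β)) {y : EucSp n}
    (hy : y ∈ nearFeasibleSet h β) (hβ : 0 < β) (hϱ : 0 < ϱ) (hL : SatisfiesLICQ h ϱ y)
    (hκ : IsLargeFactor m β ϱ M κ) (hc : 0 < c) (hcβ : 1 ≤ c * β)
    (hgrad : 4 * ‖gradient f y‖ ≤ c * ϱ * β) :
    y + (1 / (c * κ)) • (-(evalAt f h y).penaltyGrad c) ∈ nearFeasibleSet h β ∧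
    penalty c f h (y + (1 / (c * κ)) • (-(evalAt f h y).penaltyGrad c)) ≤
      penalty c f h y - 1 / (2 * (c * κ)) * ‖(evalAt f h y).penaltyGrad c‖ ^ 2 := by
  have hκ0 : 0 < κ := zero_lt_one.trans_le hκ.one_le
  have hW : 0 ≤ penaltyConst m β M := by unfold penaltyConst; positivity
  have hMM : (0 : ℝ) ≤ m * M ^ 2 := by positivity
  have hmβ : (0 : ℝ) ≤ m * (β * M) := by positivity
  have hβM : (0 : ℝ) ≤ β * M := by positivity
  set W := penaltyConst m β M with hWdef
  set g := (evalAt f h y).penaltyGrad c with hg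
  set t := 1 / (c * κ) with ht
  have ht0 : 0 < t := by positivity
  have hctκ : c * t * κ = 1 := by rw [ht]; field_simp
  have hct : c * t = κ⁻¹ := eq_inv_of_mul_eq_one_left hctκ
  have hgW : ‖g‖ ≤ c * W := (norm_penaltyGrad_le hh hc.le hB hy).trans
    (add_mul_le_mul_penaltyConst hcβ hc.le (by linarith))
  have hseg : ∀ s ∈ Icc 0 t, y + s • (-g) ∈ nearFeasibleSet h β := by
    -- If `‖h y‖ ≤ β/2`, the step has length at most `W/κ` and cannot reach the boundary. Otherwise
    -- LICQ and `hgrad` make the constraint part of `g` dominate.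
    rcases le_or_gt ‖h y‖ (β / 2) with hle | hgt
    · refine segment_mem_of_short hh hB ?_ ht0.le
      have h1 : m * M * (t * ‖-g‖) ≤ m * M * W * κ⁻¹ := by
        rw [norm_neg, mul_assoc _ W, ← hct]
        refine mul_le_mul_of_nonneg_left ?_ (by positivity)
        calc t * ‖g‖ ≤ t * (c * W) := by gcongr
          _ = _ := by ring
      have h2 : m * M * W * κ⁻¹ < β / 4 := by
        rw [← div_eq_mul_inv, div_lt_iff₀ hκ0]
        linarith [hκ.displacement_lt]
      linarith
    · have hw := hL.mul_norm_le hϱ (h y)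
      have hw2 : ϱ * (β / 2) < ‖ContinuousLinearMap.adjoint (fderiv ℝ h y) (h y)‖ :=
        (mul_lt_mul_of_pos_left hgt hϱ).trans_le hw
      refine segment_mem_of_neg_penaltyGrad hh hB hy hc (lt_trans (by positivity) hw2) ?_ ?_
      · linarith [mul_lt_mul_of_pos_left hw2 hc]
      · rw [hct, ← div_eq_inv_mul, ← mul_div_assoc, div_lt_one hκ0]
        have h1 : M + m * (M ^ 2 + β * M) ≤ W := by
          rw [hWdef, penaltyConst]
          linarith
        linarith [hκ.const_le]
  refine ⟨hseg t ⟨ht0.le, le_rfl⟩, ?_⟩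
  have hT := le_taylor_two (L := c * W * ‖g‖ ^ 2) ht0.le
    (hasDerivAt_penalty_line hf hh c y (-g)) (hasDerivAt_penaltyGrad_line hf hh c y (-g))
    fun s hs => by
      have h1 := (le_abs_self _).trans (abs_penaltyCurv_le hh hc.le hB (hseg s hs) (-g))
      rw [norm_neg] at h1
      refine h1.trans (mul_le_mul_of_nonneg_right ?_ (sq_nonneg _))
      exact add_mul_le_mul_penaltyConst hcβ hc.le (by linarith)
  simp only [zero_smul, add_zero, ← hg, inner_neg_right, real_inner_self_eq_norm_sq] at hT
  have hWt : c * t * W ≤ 1 := by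
    rw [hct, ← div_eq_inv_mul, div_le_one hκ0]
    linarith [hκ.const_le]
  have h2 : 1 / (2 * (c * κ)) = t / 2 := by rw [ht]; field_simp
  rw [h2]
  have h3 := mul_le_mul_of_nonneg_right hWt (by positivity : 0 ≤ t * ‖g‖ ^ 2)
  linarith

/-- In the Taylor bound the linear term is nonpositive, the quadratic one is at most `-ε t²/4`, and
the cubic one is at most `ε t²/30` because `c W t ≤ ε/5`. -/
theorem penalty_curvature_step (hf : ContDiff ℝ 2 f) (hh : ContDiff ℝ 2 h)
    (hB : HasBddLipschitzData f h M (nearFeasibleSet h β)) {y u : EucSp n} {ε : ℝ}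
    (hy : ‖h y‖ ≤ β / 4) (hβ : 0 < β) (hκ : IsLargeFactor m β ϱ M κ) (hc : 0 < c)
    (hcβ : 1 ≤ c * β) (hε : 0 < ε) (hu : ‖u‖ = 1)
    (hcurv : (evalAt f h y).penaltyCurv c u ≤ -ε / 2)
    (hgu : inner ℝ ((evalAt f h y).penaltyGrad c) u ≤ 0) :
    y + (ε / (c * κ)) • u ∈ nearFeasibleSet h β ∧
    penalty c f h (y + (ε / (c * κ)) • u) ≤ penalty c f h y - ε ^ 3 / (8 * c ^ 2 * κ ^ 2) := by
  have hκ0 : 0 < κ := zero_lt_one.trans_le hκ.one_le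
  have hyS : y ∈ nearFeasibleSet h β := hy.trans (by linarith)
  have hW : 0 ≤ penaltyConst m β M := by unfold penaltyConst; positivity
  have hMM : (0 : ℝ) ≤ m * M ^ 2 := by positivity
  set W := penaltyConst m β M with hWdef
  set t := ε / (c * κ) with ht
  have ht0 : 0 < t := by positivity
  have hctκ : c * t * κ = ε := by rw [ht]; field_simp
  -- Negative curvature of size `ε/2` cannot exceed the Hessian bound. This bounds the step length,
  -- although `ε` itself has no prescribed upper bound.
  have hεW : ε / 2 ≤ c * W := by
    have h1 := (neg_le_abs _).trans (abs_penaltyCurv_le hh hc.le hB hyS u)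
    rw [hu, one_pow, mul_one] at h1
    have h2 : (M + c * (m * (M ^ 2 + β * M)) : ℝ) ≤ c * W :=
      add_mul_le_mul_penaltyConst hcβ hc.le (by linarith)
    linarith
  have htW : t * κ ≤ 2 * W := by
    refine le_of_mul_le_mul_left ?_ hc
    linarith
  have hseg : ∀ s ∈ Icc 0 t, y + s • u ∈ nearFeasibleSet h β := by
    refine segment_mem_of_short hh hB ?_ ht0.le
    have h1 : m * M * (t * ‖u‖) < β / 2 := by
      refine lt_of_mul_lt_mul_right ?_ hκ0.le
      have h2 := mul_le_mul_of_nonneg_left htW (by positivity : (0 : ℝ) ≤ m * M)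
      rw [hu]
      linarith [hκ.displacement_lt]
    linarith
  refine ⟨hseg t ⟨ht0.le, le_rfl⟩, ?_⟩
  have hT := le_taylor_three (L := c * W) ht0.le
    (hasDerivAt_penalty_line hf hh c y u) (hasDerivAt_penaltyGrad_line hf hh c y u)
    fun s hs => by
      have hnorm : ‖y + s • u - y‖ = s := by
        rw [add_sub_cancel_left, norm_smul, hu, mul_one, Real.norm_of_nonneg hs.1]
      have h1 := penaltyCurv_le_add hh hc.le hB hyS (hseg s hs) (fun i => by
        have := abs_coord_sub_le hh hB hs.1 (fun r hr => hseg r ⟨hr.1, hr.2.trans hs.2⟩) i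
        rw [hnorm]
        rwa [hu, mul_one] at this) u
      rw [hnorm, hu, one_pow, mul_one] at h1
      simp only [zero_smul, add_zero]
      refine h1.trans (add_le_add le_rfl (mul_le_mul_of_nonneg_right ?_ hs.1))
      exact add_mul_le_mul_penaltyConst hcβ hc.le le_rfl
  simp only [zero_smul, add_zero] at hT
  have h1 : c * W * t ≤ ε / 5 := by
    have := mul_le_mul_of_nonneg_left hκ.const_le (by positivity : 0 ≤ c * t)
    linarith
  have h2 := mul_le_mul_of_nonneg_right h1 (sq_nonneg t)
  have h3 := mul_le_mul_of_nonneg_right hcurv (sq_nonneg t)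
  have h4 := mul_nonpos_of_nonpos_of_nonneg hgu ht0.le
  have h5 : ε ^ 3 / (8 * c ^ 2 * κ ^ 2) = ε * t ^ 2 / 8 := by rw [ht]; field_simp
  have h6 : 0 ≤ ε * t ^ 2 := by positivity
  rw [h5]
  linarith

end Steps

/-! ### Acceptance test and progress of one step. -/

/-- The part of the condition of being an AFAC pair that can be read off from an evaluation,
together with a bound on the multiplier. -/
structure EvalData.IsAccepted {n m : ℕ} (D : EvalData n m) (T : Tolerances) (lam : EucSp m) :
    Prop where
  feasible : ‖D.hVal‖ ≤ T.ε₀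
  first_order : ‖D.fGrad + ContinuousLinearMap.adjoint D.hJac lam‖ ≤ T.ε₁
  second_order : ∀ u : EucSp n, ‖u‖ = 1 → ‖D.hJac u‖ ≤ T.γ →
    -T.ε₂ ≤ inner ℝ u ((D.fHess + ∑ i, lam i • D.hHess i) u)
  multiplier : ‖lam‖ ≤ 2 ∨ ‖ContinuousLinearMap.adjoint D.hJac lam‖ ≤ 2 * ‖D.fGrad‖

open Classical in
/-- A step of the penalty method: a gradient step if the gradient of the penalty function is not
small, otherwise a step along a direction of negative curvature. -/
def EvalData.penaltyStep {n m : ℕ} (D : EvalData n m) (c κ ε₁ ε₂ : ℝ) (y : EucSp n) : EucSp n :=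
  if ε₁ / κ < ‖D.penaltyGrad c‖ then y + (1 / (c * κ)) • (-D.penaltyGrad c)
  else if hu : ∃ u, ‖u‖ = 1 ∧ D.penaltyCurv c u ≤ -ε₂ / 2 ∧ inner ℝ (D.penaltyGrad c) u ≤ 0 then
    y + (ε₂ / (c * κ)) • hu.choose
  else y

theorem EvalData.penaltyCurv_neg {n m : ℕ} (D : EvalData n m) (c : ℝ) (u : EucSp n) :
    D.penaltyCurv c (-u) = D.penaltyCurv c u := by
  simp [EvalData.penaltyCurv]

section Acceptance

variable {n m : ℕ} {f : EucSp n → ℝ} {h : EucSp n → EucSp m} {β ϱ κ p R : ℝ} {M : ℝ≥0}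
  {T : Tolerances}

theorem EvalData.IsAccepted.isAFACPair (hf : ContDiff ℝ 2 f) (hh : ContDiff ℝ 2 h)
    {y : EucSp n} {lam : EucSp m} (hA : (evalAt f h y).IsAccepted T lam) :
    IsAFACPair f h T.ε₀ T.ε₁ T.ε₂ T.γ y lam where
  feasible := hA.feasible
  first_order := by
    rw [gradient_lagrangian hf hh]
    exact hA.first_order
  second_order := by
    rw [hessianOp_lagrangian hf hh]
    exact hA.second_order

/-- The multiplier test involves neither `ϱ` nor `L_f`, so the algorithm can perform it; LICQ turns
either alternative into the required bound. -/
theorem EvalData.IsAccepted.norm_le {y : EucSp n} {lam : EucSp m}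
    (hA : (evalAt f h y).IsAccepted T lam) (hϱ : 0 < ϱ) (hL : SatisfiesLICQ h ϱ y)
    {Lf : ℝ} (hLf : ‖gradient f y‖ ≤ Lf) : ‖lam‖ ≤ multiplierBound ϱ Lf := by
  have h0 : 0 ≤ ϱ⁻¹ * Lf := mul_nonneg (inv_nonneg.2 hϱ.le) ((norm_nonneg _).trans hLf)
  rw [multiplierBound]
  rcases hA.multiplier with h2 | h2
  · linarith
  · have h3 : ϱ * ‖lam‖ ≤ 2 * Lf :=
      (hL.mul_norm_le hϱ lam).trans (h2.trans (mul_le_mul_of_nonneg_left hLf zero_le_two))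
    rw [← le_inv_mul_iff₀ hϱ] at h3
    linarith

/-- At a point with small penalty gradient that is not accepted there is a descent direction of
negative curvature. -/
theorem exists_neg_curvature_of_not_isAccepted {y : EucSp n} {Lf : ℝ} (hϱ : 0 < ϱ)
    (hL : SatisfiesLICQ h ϱ y) (hLf : ‖gradient f y‖ ≤ Lf) (hR : R = multiplierBound ϱ Lf)
    (hκ1 : 1 ≤ κ) (hκϱ : 1 ≤ κ * ϱ) (h₀ : 0 < T.ε₀) (h₁ : 0 < T.ε₁) (h₁' : T.ε₁ ≤ 1)
    (h₂ : 0 < T.ε₂) (hpR : 2 * R ≤ p) (hpR' : p ≤ 8 * R ^ 3)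
    (hγ : T.γ ^ 2 ≤ 1 / 16 * (R ^ 3)⁻¹ * T.ε₀ * T.ε₂)
    (hg : ‖(evalAt f h y).penaltyGrad (p / T.ε₀)‖ ≤ T.ε₁ / κ) :
    ‖h y‖ ≤ T.ε₀ / 4 ∧ ((evalAt f h y).IsAccepted T ((p / T.ε₀) • h y) ∨
      ∃ u, ‖u‖ = 1 ∧ (evalAt f h y).penaltyCurv (p / T.ε₀) u ≤ -T.ε₂ / 2 ∧
        inner ℝ ((evalAt f h y).penaltyGrad (p / T.ε₀)) u ≤ 0) := by
  have hκ0 : 0 < κ := zero_lt_one.trans_le hκ1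
  have hLf0 : 0 ≤ ϱ⁻¹ * Lf := mul_nonneg (inv_nonneg.2 hϱ.le) ((norm_nonneg _).trans hLf)
  have hR2 : R = 2 + 2 * (ϱ⁻¹ * Lf) := by rw [hR, multiplierBound]; ring
  have hp : 0 < p := by linarith
  have hR0 : 0 < R := by linarith
  set c := p / T.ε₀ with hcdef
  have hc : 0 < c := by positivity
  have hcε : c * T.ε₀ = p := div_mul_cancel₀ _ h₀.ne'
  have hεκ : T.ε₁ / κ ≤ ϱ := by
    rw [div_le_iff₀ hκ0, mul_comm]
    linarith
  set J := fderiv ℝ h y with hJ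
  set w := ContinuousLinearMap.adjoint J (c • h y) with hw
  have hgw : (evalAt f h y).penaltyGrad c = gradient f y + w := by
    rw [hw, map_smul]
    rfl
  have hlam : ϱ * ‖c • h y‖ ≤ ‖w‖ := hL.mul_norm_le hϱ (c • h y)
  have hwn : ‖w‖ ≤ ‖gradient f y‖ + T.ε₁ / κ := by
    have h1 : w = (evalAt f h y).penaltyGrad c - gradient f y := by rw [hgw]; abel
    rw [h1]
    refine (norm_sub_le _ _).trans ?_
    linarith
  -- `ϱ‖λ‖ ≤ L_f + ε₁/κ ≤ L_f + ϱ`, and `ϱ⁻¹ L_f + 1 = R/2`.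
  have hlamR : ‖c • h y‖ ≤ R / 2 := by
    have h1 : ϱ * ‖c • h y‖ ≤ Lf + ϱ := by linarith
    rw [← le_inv_mul_iff₀ hϱ, mul_add, inv_mul_cancel₀ hϱ.ne'] at h1
    linarith
  have hfeas : ‖h y‖ ≤ T.ε₀ / 4 := by
    rw [norm_smul, Real.norm_of_nonneg hc.le] at hlamR
    refine le_of_mul_le_mul_left ?_ hc
    linarith
  refine ⟨hfeas, ?_⟩
  by_contra! hcon
  obtain ⟨hna, hno⟩ := hcon
  refine hna ⟨hfeas.trans (by linarith), ?_, ?_, ?_⟩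
  · change ‖gradient f y + w‖ ≤ T.ε₁
    rw [← hgw]
    exact hg.trans (div_le_self h₁.le hκ1)
  · intro u hu huγ
    by_contra! hlt
    have hcurv : (evalAt f h y).penaltyCurv c u ≤ -T.ε₂ / 2 := by
      have h1 : (evalAt f h y).penaltyCurv c u =
          inner ℝ u (((evalAt f h y).fHess + ∑ i, (c • h y) i • (evalAt f h y).hHess i) u) +
            c * ‖J u‖ ^ 2 := by
        simp only [EvalData.penaltyCurv, evalAt, add_apply, inner_add_right, sum_apply, inner_sum,
          smul_apply, inner_smul_right, PiLp.smul_apply, smul_eq_mul, mul_add, Finset.mul_sum,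
          mul_assoc]
        ring
      have h2 : c * ‖J u‖ ^ 2 ≤ T.ε₂ / 2 := by
        have h3 : ‖J u‖ ^ 2 ≤ 1 / 16 * (R ^ 3)⁻¹ * T.ε₀ * T.ε₂ :=
          (pow_le_pow_left₀ (norm_nonneg _) huγ 2).trans hγ
        calc c * ‖J u‖ ^ 2 ≤ c * (1 / 16 * (R ^ 3)⁻¹ * T.ε₀ * T.ε₂) := by gcongr
          _ = p * (1 / 16 * (R ^ 3)⁻¹ * T.ε₂) := by rw [← hcε]; ring
          _ ≤ 8 * R ^ 3 * (1 / 16 * (R ^ 3)⁻¹ * T.ε₂) := by gcongr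
          _ = T.ε₂ / 2 := by field_simp; norm_num
      rw [h1]
      linarith
    -- Curvature is even in `u`, so one of `u` and `-u` is not an ascent direction.
    have h3 := hno u hu hcurv
    have h4 := hno (-u) (by rwa [norm_neg]) (by rwa [EvalData.penaltyCurv_neg])
    rw [inner_neg_right] at h4
    linarith
  · change ‖c • h y‖ ≤ 2 ∨ ‖w‖ ≤ 2 * ‖gradient f y‖
    -- If `∇f` dominates the residual `ε₁/κ`, then `‖w‖ ≤ 2‖∇f‖`; otherwise `‖w‖ ≤ 2ε₁/κ ≤ 2ϱ`, and
    -- LICQ gives `‖λ‖ ≤ 2`.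
    rcases le_or_gt (T.ε₁ / κ) ‖gradient f y‖ with hle | hgt
    · exact Or.inr (by linarith)
    · refine Or.inl (le_of_mul_le_mul_left ?_ hϱ)
      linarith

/-- A step of the penalty method from a point that is not accepted stays in `{‖h‖ ≤ β}` and
decreases the penalty function. -/
theorem penaltyStep_spec (hf : ContDiff ℝ 2 f) (hh : ContDiff ℝ 2 h)
    (hB : HasBddLipschitzData f h M (nearFeasibleSet h β)) {y : EucSp n} {Lf : ℝ}
    (hy : y ∈ nearFeasibleSet h β) (hβ : 0 < β) (hϱ : 0 < ϱ)
    (hL : SatisfiesLICQ h ϱ y) (hLf : ‖gradient f y‖ ≤ Lf) (hR : R = multiplierBound ϱ Lf)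
    (hκ : IsLargeFactor m β ϱ M κ) (h₀ : 0 < T.ε₀) (h₀' : T.ε₀ ≤ β) (h₁ : 0 < T.ε₁)
    (h₁' : T.ε₁ ≤ 1) (h₂ : 0 < T.ε₂) (hpR : 2 * R ≤ p) (hpR' : p ≤ 8 * R ^ 3)
    (hγ : T.γ ^ 2 ≤ 1 / 16 * (R ^ 3)⁻¹ * T.ε₀ * T.ε₂)
    (hna : ¬ (evalAt f h y).IsAccepted T ((p / T.ε₀) • h y)) :
    (evalAt f h y).penaltyStep (p / T.ε₀) κ T.ε₁ T.ε₂ y ∈ nearFeasibleSet h β ∧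
    penalty (p / T.ε₀) f h ((evalAt f h y).penaltyStep (p / T.ε₀) κ T.ε₁ T.ε₂ y) ≤
      penalty (p / T.ε₀) f h y - min (T.ε₁ ^ 2 / (2 * (p / T.ε₀) * κ ^ 3))
        (T.ε₂ ^ 3 / (8 * (p / T.ε₀) ^ 2 * κ ^ 2)) := by
  have hκ0 : 0 < κ := zero_lt_one.trans_le hκ.one_le
  have hLf0 : 0 ≤ ϱ⁻¹ * Lf := mul_nonneg (inv_nonneg.2 hϱ.le) ((norm_nonneg _).trans hLf)
  have hR2 : R = 2 + 2 * (ϱ⁻¹ * Lf) := by rw [hR, multiplierBound]; ring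
  have hp : 0 < p := by linarith
  have hexists := exists_neg_curvature_of_not_isAccepted hϱ hL hLf hR hκ.one_le hκ.one_le_mul
    h₀ h₁ h₁' h₂ hpR hpR' hγ
  set c := p / T.ε₀ with hcdef
  have hc : 0 < c := by positivity
  have hcβ : p ≤ c * β := by
    rw [hcdef, div_mul_eq_mul_div, le_div_iff₀ h₀]
    gcongr
  have hcβ1 : 1 ≤ c * β := by linarith
  unfold EvalData.penaltyStep
  split_ifs with hg hu
  -- `4 L_f ≤ 2ϱR ≤ ϱp ≤ cϱβ`.
  · have h1 : 4 * ‖gradient f y‖ ≤ c * ϱ * β := by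
      have h2 : ϱ * p ≤ ϱ * (c * β) := by gcongr
      have h3 : ϱ * (2 * R) ≤ ϱ * p := by gcongr
      have h4 : ϱ * (ϱ⁻¹ * Lf) = Lf := mul_inv_cancel_left₀ hϱ.ne' Lf
      rw [hR2] at h3
      linarith
    obtain ⟨hS, hdec⟩ := penalty_gradient_step hf hh hB hy hβ hϱ hL hκ hc hcβ1 h1
    refine ⟨hS, hdec.trans (sub_le_sub_left ((min_le_left _ _).trans ?_) _)⟩
    calc T.ε₁ ^ 2 / (2 * c * κ ^ 3) = 1 / (2 * (c * κ)) * (T.ε₁ / κ) ^ 2 := by field_simp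
      _ ≤ _ := by gcongr
  · obtain ⟨hfe, -⟩ := hexists (not_lt.1 hg)
    obtain ⟨hS, hdec⟩ := penalty_curvature_step hf hh hB (hfe.trans (by linarith)) hβ hκ hc hcβ1
      h₂ hu.choose_spec.1 hu.choose_spec.2.1 hu.choose_spec.2.2
    exact ⟨hS, hdec.trans (sub_le_sub_left (min_le_right _ _) _)⟩
  · exact absurd ((hexists (not_lt.1 hg)).2.resolve_left hna) hu

end Acceptance

/-! ### The restarted algorithm and its runs. -/

/-- The state of the restarted penalty method: the tolerances, the initial point, the index of the
current run, the number of steps made in it and the current point. -/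
structure PenaltyState (n : ℕ) : Type where
  tol : Tolerances
  start : EucSp n
  stage : ℕ
  count : ℕ
  point : EucSp n

/-- The penalty parameter of the `j`-th run. -/
def stagePenalty (T : Tolerances) (j : ℕ) : ℝ := (Nat.unpair j).1 / T.ε₀

/-- The step size parameter of the `j`-th run. -/
def stageFactor (j : ℕ) : ℝ := (Nat.unpair j).2

/-- The factor in the number of steps of the `j`-th run. -/
def stageCost (j : ℕ) : ℝ := 8 * (Nat.unpair j).1 ^ 3 * (Nat.unpair j).2 ^ 4

/-- The dependence of the number of evaluations on the tolerances. -/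
def Tolerances.rate (T : Tolerances) : ℝ :=
  max ((T.ε₀ ^ 2 * T.ε₁ ^ 2)⁻¹) ((T.ε₀ ^ 3 * T.ε₂ ^ 3)⁻¹)

/-- The number of evaluations allowed in the `j`-th run. -/
def stageBudget (T : Tolerances) (j : ℕ) : ℕ := ⌊stageCost j * T.rate⌋₊ + 1

open Classical in
/-- The penalty method, restarted with further parameters whenever a run has not found an
acceptable point within its budget. -/
def penaltyAlgorithm (n m : ℕ) : EvalAlgorithm n m where
  State := PenaltyState n ⊕ (EucSp n × EucSp m)
  init y T := Sum.inl ⟨T, y, 0, 0, y⟩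
  act := Sum.elim (fun s => Sum.inl s.point) Sum.inr
  next s D := s.elim
    (fun s =>
      if D.IsAccepted s.tol (stagePenalty s.tol s.stage • D.hVal) then
        Sum.inr (s.point, stagePenalty s.tol s.stage • D.hVal)
      else if s.count + 1 < stageBudget s.tol s.stage then
        Sum.inl ⟨s.tol, s.start, s.stage, s.count + 1,
          D.penaltyStep (stagePenalty s.tol s.stage) (stageFactor s.stage) s.tol.ε₁ s.tol.ε₂
            s.point⟩
      else Sum.inl ⟨s.tol, s.start, s.stage + 1, 0, s.start⟩)
    Sum.inr

/-- The iterates of the penalty method. -/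
def penaltyIterate {n m : ℕ} (f : EucSp n → ℝ) (h : EucSp n → EucSp m) (c κ ε₁ ε₂ : ℝ)
    (y₀ : EucSp n) : ℕ → EucSp n
  | 0 => y₀
  | k + 1 =>
    (evalAt f h (penaltyIterate f h c κ ε₁ ε₂ y₀ k)).penaltyStep c κ ε₁ ε₂
      (penaltyIterate f h c κ ε₁ ε₂ y₀ k)

section Run

variable {n m : ℕ} {f : EucSp n → ℝ} {h : EucSp n → EucSp m} {T : Tolerances} {y₀ : EucSp n}

/-- If some iterate of run `J` is acceptable, then the algorithm stops with an acceptable output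
within the total budget of the runs up to `J`. -/
theorem exists_runsTo_of_isAccepted {J k₀ : ℕ} (hk₀ : k₀ < stageBudget T J)
    (hacc : (evalAt f h (penaltyIterate f h (stagePenalty T J) (stageFactor J) T.ε₁ T.ε₂ y₀ k₀)
      ).IsAccepted T (stagePenalty T J • h (penaltyIterate f h (stagePenalty T J) (stageFactor J)
        T.ε₁ T.ε₂ y₀ k₀))) :
    ∀ b j k : ℕ, j ≤ J → k < stageBudget T j → (j = J → k ≤ k₀) →
      ∑ i ∈ Finset.Ico j (J + 1), stageBudget T i = b + k →
      ∃ (N : ℕ) (y : EucSp n) (lam : EucSp m),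
        (penaltyAlgorithm n m).RunsTo f h (Sum.inl ⟨T, y₀, j, k,
          penaltyIterate f h (stagePenalty T j) (stageFactor j) T.ε₁ T.ε₂ y₀ k⟩) N (y, lam) ∧
        N ≤ b ∧ (evalAt f h y).IsAccepted T lam := by
  intro b
  -- Here `b` counts the evaluations left in the budgets of runs `j, …, J` after `k` have been made
  -- in run `j`. It cannot be zero, because `k` is below the budget of run `j`.
  induction b with
  | zero =>
    intro j k hj hk _ hsum
    rw [Finset.sum_eq_sum_Ico_succ_bot (by omega)] at hsum
    omega
  | succ b ih =>
    intro j k hj hk hjJ hsum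
    set x := penaltyIterate f h (stagePenalty T j) (stageFactor j) T.ε₁ T.ε₂ y₀ k with hx
    have hact : (penaltyAlgorithm n m).act (Sum.inl ⟨T, y₀, j, k, x⟩) = Sum.inl x := rfl
    by_cases hA : (evalAt f h x).IsAccepted T (stagePenalty T j • h x)
    · refine ⟨1, x, stagePenalty T j • h x, ?_, by omega, hA⟩
      refine EvalAlgorithm.RunsTo.query hact (EvalAlgorithm.RunsTo.halt ?_)
      have : (penaltyAlgorithm n m).next (Sum.inl ⟨T, y₀, j, k, x⟩) (evalAt f h x)
          = Sum.inr (x, stagePenalty T j • h x) := if_pos hA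
      rw [this]
      rfl
    by_cases hb : k + 1 < stageBudget T j
    · have hnext : (penaltyAlgorithm n m).next (Sum.inl ⟨T, y₀, j, k, x⟩) (evalAt f h x)
          = Sum.inl ⟨T, y₀, j, k + 1,
            penaltyIterate f h (stagePenalty T j) (stageFactor j) T.ε₁ T.ε₂ y₀ (k + 1)⟩ :=
        (if_neg hA).trans (if_pos hb)
      obtain ⟨N, y, lam, hrun, hN, hacc'⟩ := ih j (k + 1) hj hb (fun hjJ' => by
        have hle := hjJ hjJ'
        rcases hle.lt_or_eq with hlt | heq
        · exact hlt
        · subst hjJ' heq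
          exact absurd hacc hA) (by omega)
      exact ⟨N + 1, y, lam, EvalAlgorithm.RunsTo.query hact (hnext ▸ hrun), by omega, hacc'⟩
    · have hnext : (penaltyAlgorithm n m).next (Sum.inl ⟨T, y₀, j, k, x⟩) (evalAt f h x)
          = Sum.inl ⟨T, y₀, j + 1, 0, y₀⟩ :=
        (if_neg hA).trans (if_neg hb)
      -- Run `J` cannot exhaust its budget: it would have to pass the acceptable iterate `k₀`.
      have hlt : j < J := by
        rcases hj.lt_or_eq with hlt | heq
        · exact hlt
        · have hle := hjJ heq
          rcases hle.lt_or_eq with hlt | heq'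
          · subst heq
            omega
          · subst heq heq'
            exact absurd hacc hA
      rw [Finset.sum_eq_sum_Ico_succ_bot (by omega)] at hsum
      obtain ⟨N, y, lam, hrun, hN, hacc'⟩ := ih (j + 1) 0 hlt (Nat.succ_pos _)
        (fun _ => Nat.zero_le _) (by omega)
      exact ⟨N + 1, y, lam, EvalAlgorithm.RunsTo.query hact (hnext ▸ hrun), by omega, hacc'⟩

end Run

/-! ### Step count of a run with suitable parameters. -/

section Convergence

variable {n m : ℕ} {f : EucSp n → ℝ} {h : EucSp n → EucSp m} {β ϱ κ p R : ℝ} {M : ℝ≥0}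
  {T : Tolerances} {y₀ : EucSp n}

/-- With suitable parameters the penalty method finds an acceptable point within its budget. -/
theorem exists_isAccepted_penaltyIterate (hf : ContDiff ℝ 2 f) (hh : ContDiff ℝ 2 h)
    (hB : HasBddLipschitzData f h M (nearFeasibleSet h β)) {Lf : ℝ}
    (hy₀ : y₀ ∈ nearFeasibleSet h β) (hβ : 0 < β) (hϱ : 0 < ϱ)
    (hL : ∀ y ∈ nearFeasibleSet h β, SatisfiesLICQ h ϱ y)
    (hLf : ∀ y ∈ nearFeasibleSet h β, ‖gradient f y‖ ≤ Lf) (hR : R = multiplierBound ϱ Lf)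
    (hκ : IsLargeFactor m β ϱ M κ) (h₀ : 0 < T.ε₀) (h₀' : T.ε₀ ≤ β) (h₁ : 0 < T.ε₁)
    (h₁' : T.ε₁ ≤ 1) (h₂ : 0 < T.ε₂) (hp1 : 1 ≤ p) (hpR : 2 * R ≤ p) (hpR' : p ≤ 8 * R ^ 3)
    (hγ : T.γ ^ 2 ≤ 1 / 16 * (R ^ 3)⁻¹ * T.ε₀ * T.ε₂) {B : ℕ}
    (hBud : 8 * p ^ 3 * κ ^ 4 * T.rate < B) :
    ∃ k < B, (evalAt f h (penaltyIterate f h (p / T.ε₀) κ T.ε₁ T.ε₂ y₀ k)).IsAccepted T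
      ((p / T.ε₀) • h (penaltyIterate f h (p / T.ε₀) κ T.ε₁ T.ε₂ y₀ k)) := by
  by_contra! hcon
  have hκ0 : 0 < κ := zero_lt_one.trans_le hκ.one_le
  have hp : 0 < p := by linarith
  set c := p / T.ε₀ with hcdef
  have hc : 0 < c := by positivity
  have hcβ : 1 ≤ c * β := by
    rw [hcdef, div_mul_eq_mul_div, le_div_iff₀ h₀, one_mul]
    exact h₀'.trans (le_mul_of_one_le_left hβ.le hp1)
  set δ := min (T.ε₁ ^ 2 / (2 * c * κ ^ 3)) (T.ε₂ ^ 3 / (8 * c ^ 2 * κ ^ 2)) with hδ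
  have hδ0 : 0 < δ := lt_min (by positivity) (by positivity)
  have hind : ∀ k ≤ B, penaltyIterate f h c κ T.ε₁ T.ε₂ y₀ k ∈ nearFeasibleSet h β ∧
      penalty c f h (penaltyIterate f h c κ T.ε₁ T.ε₂ y₀ k) ≤ penalty c f h y₀ - k * δ := by
    intro k
    induction k with
    | zero => intro _; exact ⟨hy₀, by simp [penaltyIterate]⟩
    | succ k ih =>
      intro hk
      obtain ⟨hS, hle⟩ := ih (by omega)
      obtain ⟨hS', hle'⟩ := penaltyStep_spec hf hh hB hS hβ hϱ (hL _ hS) (hLf _ hS) hR hκ h₀ h₀' h₁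
        h₁' h₂ hpR hpR' hγ (hcon k (by omega))
      refine ⟨hS', hle'.trans ?_⟩
      push_cast
      rw [← hcdef, ← hδ]
      linarith
  obtain ⟨hS, hle⟩ := hind B le_rfl
  -- Both endpoints lie in the set, so `f` drops by at most `2M ≤ 2cβM`, and the penalty term by at
  -- most `cβ²/2`.
  have hgap : (B : ℝ) * δ ≤ c * κ := by
    have e1 := (abs_le.1 (hB.objective.1 _ hS)).1
    have e2 := (abs_le.1 (hB.objective.1 _ hy₀)).2
    have e3 : ‖h y₀‖ ^ 2 ≤ β ^ 2 := pow_le_pow_left₀ (norm_nonneg _) hy₀ 2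
    have e4 := mul_le_mul_of_nonneg_left e3 (by positivity : 0 ≤ c / 2)
    have e5 : 0 ≤ c / 2 * ‖h (penaltyIterate f h c κ T.ε₁ T.ε₂ y₀ B)‖ ^ 2 := by positivity
    have e6 : (M : ℝ) ≤ c * β * M := le_mul_of_one_le_left M.2 hcβ
    have e7 := mul_le_mul_of_nonneg_left hκ.gap_le hc.le
    unfold penalty at hle
    linarith
  -- `cκ/δ` is the larger of `2p²κ⁴/(ε₀²ε₁²)` and `8p³κ³/(ε₀³ε₂³)`; the factor `8p³κ⁴` covers both.
  have hrate : c * κ ≤ 8 * p ^ 3 * κ ^ 4 * T.rate * δ := by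
    rw [hδ]
    have hX : 0 < 8 * p ^ 3 * κ ^ 4 := by positivity
    rcases min_choice (T.ε₁ ^ 2 / (2 * c * κ ^ 3)) (T.ε₂ ^ 3 / (8 * c ^ 2 * κ ^ 2)) with hm | hm
    · rw [hm]
      have h1 : (T.ε₀ ^ 2 * T.ε₁ ^ 2)⁻¹ ≤ T.rate := le_max_left _ _
      calc c * κ ≤ c * κ * (4 * p) := le_mul_of_one_le_right (by positivity) (by linarith)
        _ = 8 * p ^ 3 * κ ^ 4 * (T.ε₀ ^ 2 * T.ε₁ ^ 2)⁻¹ * (T.ε₁ ^ 2 / (2 * c * κ ^ 3)) := by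
          rw [hcdef]; field_simp; norm_num
        _ ≤ _ := by gcongr
    · rw [hm]
      have h1 : (T.ε₀ ^ 3 * T.ε₂ ^ 3)⁻¹ ≤ T.rate := le_max_right _ _
      calc c * κ ≤ c * κ * κ := le_mul_of_one_le_right (by positivity) hκ.one_le
        _ = 8 * p ^ 3 * κ ^ 4 * (T.ε₀ ^ 3 * T.ε₂ ^ 3)⁻¹ * (T.ε₂ ^ 3 / (8 * c ^ 2 * κ ^ 2)) := by
          rw [hcdef]; field_simp
        _ ≤ _ := by gcongr
  have := mul_lt_mul_of_pos_right hBud hδ0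
  linarith

end Convergence

/-! ### Uniform constants and the main theorem. -/

theorem norm_gradient_le_gradSup {n m : ℕ} {f : EucSp n → ℝ} {h : EucSp n → EucSp m} {M : ℝ≥0}
    {S : Set (EucSp n)} (hB : HasBddLipschitzData f h M S) {y : EucSp n} (hy : y ∈ S) :
    ‖gradient f y‖ ≤ gradSup f S :=
  le_ciSup (f := fun y : S => ‖gradient f (y : EucSp n)‖)
    ⟨M, by rintro _ ⟨z, rfl⟩; exact hB.objective_grad.1 z z.2⟩ ⟨y, hy⟩

theorem gradSup_le {n m : ℕ} {f : EucSp n → ℝ} {h : EucSp n → EucSp m} {M : ℝ≥0}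
    {S : Set (EucSp n)} (hB : HasBddLipschitzData f h M S) : gradSup f S ≤ M :=
  Real.iSup_le (fun z => hB.objective_grad.1 z z.2) M.2

/-- The `+ 1` from rounding is absorbed by `β² * T.rate ≥ 1`, which follows from `ε₀ε₁ ≤ β`. -/
theorem stageBudget_le {T : Tolerances} {β : ℝ} (j : ℕ) (h₀ : 0 < T.ε₀) (h₀' : T.ε₀ ≤ β)
    (h₁ : 0 < T.ε₁) (h₁' : T.ε₁ ≤ 1) :
    (stageBudget T j : ℝ) ≤ (stageCost j + β ^ 2) * T.rate := by
  have h1 : (T.ε₀ ^ 2 * T.ε₁ ^ 2)⁻¹ ≤ T.rate := le_max_left _ _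
  have h0 : 0 < T.rate := lt_of_lt_of_le (by positivity) h1
  have h2 : 0 ≤ stageCost j * T.rate := mul_nonneg (by unfold stageCost; positivity) h0.le
  have h3 : 1 ≤ β ^ 2 * T.rate := by
    refine le_trans ?_ (mul_le_mul_of_nonneg_left h1 (sq_nonneg β))
    rw [← div_eq_mul_inv, one_le_div (by positivity), ← mul_pow]
    exact pow_le_pow_left₀ (by positivity)
      ((mul_le_of_le_one_right h₀.le h₁').trans h₀') 2
  unfold stageBudget
  push_cast
  linarith [Nat.floor_le h2]

end

theorem mainTheorem5 (n m : ℕ) :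
    ∃ A : EvalAlgorithm n m,
      ∀ (β ϱ : ℝ) (M : ℝ≥0), 0 < β → 0 < ϱ →
        ∃ C : ℝ, ∀ (f : EucSp n → ℝ) (h : EucSp n → EucSp m) (y₀ : EucSp n),
          ContDiff ℝ 2 f → ContDiff ℝ 2 h →
          y₀ ∈ nearFeasibleSet h β →
          HasBddLipschitzData f h M (nearFeasibleSet h β) →
          (∀ y ∈ nearFeasibleSet h β, SatisfiesLICQ h ϱ y) →
          ∀ R : ℝ, R = multiplierBound ϱ (gradSup f (nearFeasibleSet h β)) →
          ∀ ε₀ ε₁ ε₂ γ : ℝ, 0 < ε₀ → 0 < ε₁ → 0 < ε₂ → 0 ≤ γ →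
            ε₀ ≤ β → ε₁ ≤ 1 →
            ε₁ ^ 2 ≤ 1 / 16 * R⁻¹ * ε₀ * ε₂ →
            γ ^ 2 ≤ 1 / 16 * (R ^ 3)⁻¹ * ε₀ * ε₂ →
            ∃ (N : ℕ) (y : EucSp n) (lam : EucSp m),
              A.RunsTo f h (A.init y₀ ⟨ε₀, ε₁, ε₂, γ⟩) N (y, lam) ∧
              (N : ℝ) ≤ C * max ((ε₀ ^ 2 * ε₁ ^ 2)⁻¹) ((ε₀ ^ 3 * ε₂ ^ 3)⁻¹) ∧
              IsAFACPair f h ε₀ ε₁ ε₂ γ y lam ∧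
              ‖lam‖ ≤ R := by
  refine ⟨penaltyAlgorithm n m, fun β ϱ M hβ hϱ => ?_⟩
  obtain ⟨k, hk⟩ := exists_isLargeFactor m hβ hϱ M
  -- As `L_f ≤ M`, this bounds the parameter `⌈2R⌉` uniformly in `f` and `h`, so `C` may sum the
  -- costs of all runs up to index `Nat.pair P k`.
  set P : ℕ := ⌈2 * multiplierBound ϱ M⌉₊ with hP
  have hcost : ∀ j, 0 ≤ stageCost j + β ^ 2 := fun j => by unfold stageCost; positivity
  refine ⟨∑ j ∈ Finset.range (Nat.pair P k + 1), (stageCost j + β ^ 2), ?_⟩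
  intro f h y₀ hf hh hy₀ hB hL R hR ε₀ ε₁ ε₂ γ h₀ h₁ h₂ _ h₀' h₁' _ hγ
  set T : Tolerances := ⟨ε₀, ε₁, ε₂, γ⟩ with hT
  have hLf : ∀ y ∈ nearFeasibleSet h β,
      ‖gradient f y‖ ≤ gradSup f (nearFeasibleSet h β) := fun y hy =>
    norm_gradient_le_gradSup hB hy
  have hR2 : 2 ≤ R := by
    have : 0 ≤ 2 * ϱ⁻¹ * gradSup f (nearFeasibleSet h β) :=
      mul_nonneg (by positivity) ((norm_nonneg _).trans (hLf y₀ hy₀))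
    rw [hR, multiplierBound]
    linarith
  have hRM : R ≤ multiplierBound ϱ M := by
    rw [hR, multiplierBound, multiplierBound]
    gcongr
    exact gradSup_le hB
  set p : ℕ := ⌈2 * R⌉₊ with hp
  have hpP : p ≤ P := Nat.ceil_le_ceil (by linarith)
  have hpR : 2 * R ≤ p := Nat.le_ceil _
  have hpR' : (p : ℝ) ≤ 8 * R ^ 3 := by
    have h1 : (p : ℝ) < 2 * R + 1 := Nat.ceil_lt_add_one (by linarith)
    have h2 : 4 * R ≤ R ^ 2 * R := by
      have : (2 : ℝ) ^ 2 ≤ R ^ 2 := pow_le_pow_left₀ zero_le_two hR2 2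
      exact mul_le_mul_of_nonneg_right (by linarith) (by linarith)
    linarith [pow_succ R 2]
  set J := Nat.pair p k with hJ
  have hJP : J ≤ Nat.pair P k := by
    rcases hpP.lt_or_eq with hlt | heq
    · exact (Nat.pair_lt_pair_left k hlt).le
    · rw [hJ, heq]
  have hpen : stagePenalty T J = p / T.ε₀ := by simp [stagePenalty, hJ]
  have hfac : stageFactor J = k := by simp [stageFactor, hJ]
  have hbud : 8 * (p : ℝ) ^ 3 * (k : ℝ) ^ 4 * T.rate < (stageBudget T J : ℕ) := by
    have h1 : stageCost J = 8 * (p : ℝ) ^ 3 * (k : ℝ) ^ 4 := by simp [stageCost, hJ]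
    rw [← h1, stageBudget]
    exact_mod_cast Nat.lt_floor_add_one _
  obtain ⟨k₀, hk₀, hacc⟩ := exists_isAccepted_penaltyIterate (T := T) hf hh hB hy₀ hβ hϱ hL hLf hR
    hk h₀ h₀' h₁ h₁' h₂ (by linarith) hpR hpR' hγ hbud
  rw [← hpen, ← hfac] at hacc
  obtain ⟨N, y, lam, hrun, hN, hA⟩ := exists_runsTo_of_isAccepted hk₀ hacc
    (∑ i ∈ Finset.Ico 0 (J + 1), stageBudget T i) 0 0 (Nat.zero_le _) (Nat.succ_pos _)
    (fun _ => Nat.zero_le _) rfl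
  -- The output may come from an earlier run that has left the set, but an accepted point lies in
  -- it, so LICQ applies there.
  have hyS : y ∈ nearFeasibleSet h β := hA.feasible.trans h₀'
  refine ⟨N, y, lam, hrun, ?_, hA.isAFACPair hf hh, ?_⟩
  · have hrate : 0 ≤ T.rate := le_trans (by positivity) (le_max_left _ _)
    calc (N : ℝ) ≤ ∑ i ∈ Finset.range (J + 1), (stageBudget T i : ℝ) := by
          rw [Finset.range_eq_Ico]
          exact_mod_cast hN
      _ ≤ ∑ i ∈ Finset.range (J + 1), (stageCost i + β ^ 2) * T.rate :=
          Finset.sum_le_sum fun i _ => stageBudget_le i h₀ h₀' h₁ h₁'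
      _ ≤ ∑ i ∈ Finset.range (Nat.pair P k + 1), (stageCost i + β ^ 2) * T.rate :=
          Finset.sum_le_sum_of_subset_of_nonneg (Finset.range_mono (by omega))
            fun i _ _ => mul_nonneg (hcost i) hrate
      _ = _ := by rw [Finset.sum_mul]; rfl
  · rw [hR]
    exact hA.norm_le hϱ (hL y hyS) (hLf y hyS)
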